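/- Let $G$ be a finite simple plane graph (drawn in the plane with vertices as distinct points and edges as simple arcs that meet only in common ends) with an even number of vertices, in which every edge $e$ carries a weight $\omega_e$ from a commutative ring (for instance a real number). For a subgraph $H$ of $G$ let $M(H)$ be the sum, over all perfect matchings $P$ of $H$, of $\prod_{e\in P}\omega_e$. Write $G-v-w$ for the graph obtained from $G$ by deleting the vertices $v,w$ and all edges incident with them, and $G-e$, $G-e-e'$ for the graphs obtained by deleting only the indicated edges and no vertex. Let $e_1=a_1b_1$ and $e_2=a_2b_2$ be two independent edges of $G$ (that is, the four vertices $a_1,b_1,a_2,b_2$ are distinct) on the boundary of a face $f$ of $G$, and suppose that $a_1,b_1,a_2,b_2$ appear in this cyclic order on a face $g$ of $G$ (for instance $g=f$); that is, there is a closed topological disc which is contained in $g\cup\{a_1,b_1,a_2,b_2\}$ and whose boundary circle passes through $a_1,b_1,a_2,b_2$ in this cyclic order. Then $$M(G)\,M(G-e_1-e_2)+\omega_{e_1}\omega_{e_2}\,M(G-a_1-a_2)\,M(G-b_1-b_2)$$ $$=M(G-e_1)\,M(G-e_2)+\omega_{e_1}\omega_{e_2}\,M(G-a_1-b_2)\,M(G-a_2-b_1).$$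 -/

import Mathlib

/-- A drawing of the graph `G` in the plane (the Euclidean plane is taken as `ℂ`), that is, the
structure that makes `G` a plane graph: distinct vertices are distinct points, every edge is a
simple arc joining its two ends, the interior of an edge contains no vertex, and two different
edges have no common point except common ends. -/
structure PlaneDrawing {V : Type*} (G : SimpleGraph V) where
  /-- The point that represents a vertex. -/
  point : V → ℂ
  point_injective : Function.Injective point
  /-- The arc that represents the edge `uv`, traversed from `u` to `v`. -/
  arc : ∀ {u v : V}, G.Adj u v → Path (point u) (point v)
  arc_symm : ∀ {u v : V} (h : G.Adj u v), arc h.symm = (arc h).symm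
  arc_injective : ∀ {u v : V} (h : G.Adj u v), Function.Injective (arc h)
  eq_or_eq_of_arc_eq_point : ∀ {u v w : V} (h : G.Adj u v) (t : unitInterval),
    arc h t = point w → w = u ∨ w = v
  exists_point_of_arc_eq_arc : ∀ {u v x y : V} (h : G.Adj u v) (h' : G.Adj x y)
    (s t : unitInterval), s(u, v) ≠ s(x, y) → arc h s = arc h' t → ∃ w, arc h s = point w

namespace PlaneDrawing

variable {V : Type*} {G : SimpleGraph V} (D : PlaneDrawing G)

/-- The set of all points of the plane that lie on the drawing. -/
def carrier : Set ℂ :=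
  Set.range D.point ∪ {z | ∃ (u v : V) (h : G.Adj u v), z ∈ Set.range (D.arc h)}

/-- The faces are the connected components of the complement of the drawing. -/
def IsFace (F : Set ℂ) : Prop :=
  ∃ z ∈ D.carrierᶜ, F = connectedComponentIn D.carrierᶜ z

/-- The edge `uv` lies on the boundary of `F`. -/
def EdgeOnBoundary (F : Set ℂ) {u v : V} (h : G.Adj u v) : Prop :=
  Set.range (D.arc h) ⊆ frontier F

/-- The vertices `v 0, v 1, …, v (n - 1)` appear in this cyclic order (clockwise or
counterclockwise) on the face `F`: there is a closed topological disc, the image of the closed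
unit disc under `φ`, whose boundary circle passes through these vertices in this order and which,
apart from these vertices, lies in `F`. When the boundary of `F` is connected, this says that the
vertices occur in this cyclic order along the closed walk that bounds `F`. -/
def InCyclicOrderOn (F : Set ℂ) {n : ℕ} (v : Fin n → V) : Prop :=
  ∃ (φ : ℂ → ℂ) (θ : Fin n → ℝ),
    ContinuousOn φ (Metric.closedBall 0 1) ∧
    Set.InjOn φ (Metric.closedBall 0 1) ∧
    StrictMono θ ∧ (∀ i, θ i ∈ Set.Ico 0 (2 * Real.pi)) ∧
    (∀ i, φ (Complex.exp (θ i * Complex.I)) = D.point (v i)) ∧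
    ∀ z ∈ Metric.closedBall (0 : ℂ) 1, (∀ i, z ≠ Complex.exp (θ i * Complex.I)) → φ z ∈ F

end PlaneDrawing

/-- `P` is a perfect matching of `H`, where `H` and `P` are subgraphs of the same graph. -/
def IsPerfectMatchingOf {V : Type*} {G : SimpleGraph V} (H P : G.Subgraph) : Prop :=
  P ≤ H ∧ P.IsMatching ∧ P.verts = H.verts

open Classical in
/-- The sum `M(H)` of the weights of the perfect matchings of a subgraph `H` of `G`, the weight of
a perfect matching being the product of the weights of its edges. Only the values of `ω` at edges
of `H` matter. -/
noncomputable def matchingSum {V R : Type*} [Fintype V] [CommRing R] {G : SimpleGraph V}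
    (ω : Sym2 V → R) (H : G.Subgraph) : R :=
  ∑ P : G.Subgraph with IsPerfectMatchingOf H P, ∏ e ∈ P.edgeSet.toFinset, ω e

/-!
The core is Kuo's condensation identity, with `a, b, c, d` for `a₁, b₁, a₂, b₂` and `H` for the
graph without the edges `ab` and `cd`:
`M(H) M(H-a-b-c-d) + M(H-b-d) M(H-a-c) = M(H-c-d) M(H-a-b) + M(H-b-c) M(H-a-d)`.
Superpose the two matchings counted by a product. Both cover every vertex other than `a, b, c, d`,
so the component of `a` is a path that ends in another of these four vertices. Exchanging the two
matchings off that component swaps the two sides of the identity, unless `a` is joined to `c` and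
`b` to `d`, and such disjoint paths do not exist: closing the path from `a` to `c` by a chord of
the disc gives a loop whose winding number differs by one on the two sides of the chord, yet the
path from `b` to `d` would join these sides without meeting the loop.

Putting the edges `ab` and `cd` back, each matching sum becomes a polynomial of degree at most one
in each of their weights, and the theorem is the condensation identity multiplied by
`ω s(a, b) * ω s(c, d)`.
-/

section Logarithm

open Set Complex

theorem exists_continuousOn_log_of_convex {E : Type*} [AddCommGroup E] [Module ℝ E]
    [TopologicalSpace E] [IsTopologicalAddGroup E] [ContinuousSMul ℝ E] [LocallyConvexSpace ℝ E]
    {K : Set E} (hK : Convex ℝ K) {f : E → ℂ} (hf : ContinuousOn f K) (h0 : ∀ x ∈ K, f x ≠ 0) :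
    ∃ L : E → ℂ, ContinuousOn L K ∧ ∀ x ∈ K, exp (L x) = f x := by
  classical
  obtain rfl | ⟨x₀, hx₀⟩ := K.eq_empty_or_nonempty
  · exact ⟨0, continuousOn_empty _, by simp⟩
  have : ContractibleSpace K := hK.contractibleSpace ⟨x₀, hx₀⟩
  have := hK.locallyPathConnectedSpace
  obtain ⟨L, ⟨-, hL⟩, -⟩ := isCoveringMapOn_exp.existsUnique_continuousMap_lifts
    ⟨K.domRestrict f, hf.domRestrict⟩ (exp_log (h0 x₀ hx₀) : _ = f (⟨x₀, hx₀⟩ : K))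
    (fun x ↦ h0 x x.2)
  refine ⟨fun x ↦ if hx : x ∈ K then L ⟨x, hx⟩ else 0, ?_, fun x hx ↦ ?_⟩
  · rw [continuousOn_iff_continuous_domRestrict]
    exact L.continuous.congr fun x ↦ by simp
  · simpa [hx] using congrFun hL ⟨x, hx⟩

theorem sub_eq_sub_of_exp_eqOn {X : Type*} [TopologicalSpace X] {S : Set X}
    (hS : IsPreconnected S) {f g : X → ℂ} (hf : ContinuousOn f S) (hg : ContinuousOn g S)
    (h : ∀ x ∈ S, exp (f x) = exp (g x)) {x y : X} (hx : x ∈ S) (hy : y ∈ S) :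
    f x - f y = g x - g y := by
  have shifted : f x = g x + (f y - g y) :=
    isCoveringMap_exp.eqOn_of_comp_eqOn hS hf (hg.fun_add continuousOn_const)
      (fun z hz ↦ Subtype.ext <| by
        simp only [Function.comp_apply, exp_add, exp_sub, h z hz, h y hy,
          div_self (exp_ne_zero _), mul_one]) hy (by ring) hx
  linear_combination shifted

open Classical in
/-- The total change along `[0, 1]` of a continuous logarithm of `f`, with the junk value `0` if
there is none; for a closed curve it is `2πi` times the winding number about `0`. -/
noncomputable def logChange (f : ℝ → ℂ) : ℂ :=
  if h : ∃ L : ℝ → ℂ, ContinuousOn L (Icc 0 1) ∧ ∀ t ∈ Icc (0 : ℝ) 1, exp (L t) = f t then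
    h.choose 1 - h.choose 0
  else 0

theorem logChange_eq {f L : ℝ → ℂ} (hL : ContinuousOn L (Icc 0 1))
    (hLf : ∀ t ∈ Icc (0 : ℝ) 1, exp (L t) = f t) : logChange f = L 1 - L 0 := by
  have h : ∃ L : ℝ → ℂ, ContinuousOn L (Icc 0 1) ∧ ∀ t ∈ Icc (0 : ℝ) 1, exp (L t) = f t :=
    ⟨L, hL, hLf⟩
  rw [logChange, dif_pos h]
  exact sub_eq_sub_of_exp_eqOn isPreconnected_Icc h.choose_spec.1 hL
    (fun _ ht ↦ by rw [h.choose_spec.2 _ ht, hLf _ ht]) (by simp) (by simp)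

theorem logChange_comp {X : Type*} [TopologicalSpace X] {K : Set X} {f L : X → ℂ}
    (hL : ContinuousOn L K) (hLf : ∀ x ∈ K, exp (L x) = f x) {p : ℝ → X}
    (hp : ContinuousOn p (Icc 0 1)) (hpK : MapsTo p (Icc 0 1) K) :
    logChange (fun t ↦ f (p t)) = L (p 1) - L (p 0) :=
  logChange_eq (hL.comp hp hpK) fun _ ht ↦ hLf _ (hpK ht)

theorem logChange_boundary_rectangle {F : ℝ × ℝ → ℂ}
    (hF : ContinuousOn F (Icc 0 1 ×ˢ Icc 0 1)) (h0 : ∀ x ∈ Icc 0 1 ×ˢ Icc 0 1, F x ≠ 0) :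
    logChange (fun s ↦ F (s, 0)) + logChange (fun t ↦ F (1, t)) =
      logChange (fun t ↦ F (0, t)) + logChange (fun s ↦ F (s, 1)) := by
  obtain ⟨L, hL, hLF⟩ :=
    exists_continuousOn_log_of_convex ((convex_Icc 0 1).prod (convex_Icc 0 1)) hF h0
  rw [logChange_comp hL hLF (p := fun s ↦ (s, 0)) (by fun_prop) fun s hs ↦ ⟨hs, by simp⟩,
    logChange_comp hL hLF (p := fun t ↦ (1, t)) (by fun_prop) fun t ht ↦ ⟨by simp, ht⟩,
    logChange_comp hL hLF (p := fun t ↦ (0, t)) (by fun_prop) fun t ht ↦ ⟨by simp, ht⟩,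
    logChange_comp hL hLF (p := fun s ↦ (s, 1)) (by fun_prop) fun s hs ↦ ⟨hs, by simp⟩]
  ring

theorem logChange_comp_lineMap {E : Type*} [NormedAddCommGroup E] [NormedSpace ℝ E] {K : Set E}
    (hK : Convex ℝ K) {f : E → ℂ} (hf : ContinuousOn f K) (h0 : ∀ z ∈ K, f z ≠ 0) {x y : ℝ}
    {σ : ℝ → E} (hσ : ContinuousOn σ (uIcc x y)) (hσK : MapsTo σ (uIcc x y) K) {ℓ : ℝ → ℂ}
    (hℓ : ContinuousOn ℓ (uIcc x y)) (hℓf : ∀ u ∈ uIcc x y, exp (ℓ u) = f (σ u)) :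
    logChange (fun t ↦ f (AffineMap.lineMap (σ x) (σ y) t)) = ℓ y - ℓ x := by
  obtain ⟨L, hL, hLf⟩ := exists_continuousOn_log_of_convex hK hf h0
  have chord_mem : MapsTo (AffineMap.lineMap (k := ℝ) (σ x) (σ y)) (Icc 0 1) K := fun t ht ↦
    hK.lineMap_mem (hσK left_mem_uIcc) (hσK right_mem_uIcc) ht
  rw [logChange_comp hL hLf AffineMap.lineMap_continuous.continuousOn chord_mem,
    AffineMap.lineMap_apply_one, AffineMap.lineMap_apply_zero]
  exact sub_eq_sub_of_exp_eqOn isPreconnected_uIcc (hL.comp hσ hσK) hℓ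
    (fun u hu ↦ by rw [Function.comp_apply, hLf _ (hσK hu), hℓf u hu])
    right_mem_uIcc left_mem_uIcc

end Logarithm

section CrossingIndex

open Set Complex

/-- The change of a logarithm of `p s - q t` as `(s, t)` runs once round the boundary of the unit
square. It is `2πi` times the number of crossings of `p` and `q`, counted with signs. -/
noncomputable def crossingIndex (p q : ℝ → ℂ) : ℂ :=
  logChange (fun s ↦ p s - q 0) + logChange (fun t ↦ p 1 - q t) -
    logChange (fun t ↦ p 0 - q t) - logChange (fun s ↦ p s - q 1)

theorem crossingIndex_eq_zero {p q : ℝ → ℂ} (hp : ContinuousOn p (Icc 0 1))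
    (hq : ContinuousOn q (Icc 0 1)) (hpq : ∀ s ∈ Icc (0 : ℝ) 1, ∀ t ∈ Icc (0 : ℝ) 1, p s ≠ q t) :
    crossingIndex p q = 0 := by
  have rectangle := logChange_boundary_rectangle (F := fun x ↦ p x.1 - q x.2)
    ((hp.comp continuousOn_fst fun x hx ↦ hx.1).sub (hq.comp continuousOn_snd fun x hx ↦ hx.2))
    fun x hx ↦ sub_ne_zero.2 (hpq _ hx.1 _ hx.2)
  rw [crossingIndex]
  linear_combination rectangle

theorem crossingIndex_eq_zero_of_closed {p q γ δ : ℝ → ℂ} (hp : ContinuousOn p (Icc 0 1))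
    (hq : ContinuousOn q (Icc 0 1)) (hγ : ContinuousOn γ (Icc 0 1)) (hδ : ContinuousOn δ (Icc 0 1))
    (hγ0 : γ 0 = p 1) (hγ1 : γ 1 = p 0) (hδ0 : δ 0 = q 1) (hδ1 : δ 1 = q 0)
    (hγq : ∀ s ∈ Icc (0 : ℝ) 1, ∀ t ∈ Icc (0 : ℝ) 1, γ s ≠ q t)
    (hpδ : ∀ s ∈ Icc (0 : ℝ) 1, ∀ t ∈ Icc (0 : ℝ) 1, p s ≠ δ t)
    (hγδ : ∀ s ∈ Icc (0 : ℝ) 1, ∀ t ∈ Icc (0 : ℝ) 1, γ s ≠ δ t) : crossingIndex p q = 0 := by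
  have sum_eq_zero :
      crossingIndex p q + crossingIndex γ q + crossingIndex p δ + crossingIndex γ δ = 0 := by
    simp only [crossingIndex, hγ0, hγ1, hδ0, hδ1]
    ring
  rwa [crossingIndex_eq_zero hγ hq hγq, crossingIndex_eq_zero hp hδ hpδ,
    crossingIndex_eq_zero hγ hδ hγδ, add_zero, add_zero, add_zero] at sum_eq_zero

/-- The pairs of parameters of a curve of period `T` that represent two different points, with
`y` less than one period behind `x`. -/
def offDiagonalStrip (T : ℝ) : Set (ℝ × ℝ) :=
  {z | z.1 - z.2 ∈ Ioo 0 T}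

theorem convex_offDiagonalStrip (T : ℝ) : Convex ℝ (offDiagonalStrip T) :=
  (convex_Ioo 0 T).linear_preimage (LinearMap.fst ℝ ℝ ℝ - LinearMap.snd ℝ ℝ ℝ)

/-- The logarithm of `g x - g y` already changes when the two points trade places, since `g x - g y`
changes its sign. -/
theorem exists_log_sub_full_turn_eq {g : ℝ → ℂ} {T : ℝ} (hT : 0 < T) (hper : g.Periodic T)
    {L : ℝ × ℝ → ℂ} (hL : ContinuousOn L (offDiagonalStrip T))
    (hLg : ∀ z ∈ offDiagonalStrip T, exp (L z) = g z.1 - g z.2) :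
    ∃ κ ≠ 0, ∀ z ∈ offDiagonalStrip T, L (z.1 + T, z.2 + T) - L z = κ := by
  let swap (z : ℝ × ℝ) : ℝ × ℝ := (z.2 + T, z.1)
  have swap_mem : MapsTo swap (offDiagonalStrip T) (offDiagonalStrip T) :=
    fun z hz ↦ ⟨by simp only [swap]; linarith [hz.2], by simp only [swap]; linarith [hz.1]⟩
  have exp_swap : ∀ z ∈ offDiagonalStrip T, exp (L (swap z)) = exp (L z + Real.pi * I) :=
    fun z hz ↦ by
      rw [exp_add, exp_pi_mul_I, hLg z hz, hLg _ (swap_mem hz), hper]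
      ring
  have base_mem : (T / 2, 0) ∈ offDiagonalStrip T := ⟨by simpa, by simpa⟩
  set κ : ℂ := L (swap (T / 2, 0)) - L (T / 2, 0)
  have hκ : κ ≠ 0 := fun h ↦ by
    have := exp_swap _ base_mem
    rw [exp_add, exp_pi_mul_I, sub_eq_zero.1 h] at this
    exact exp_ne_zero (L (T / 2, 0)) (by linear_combination this / 2)
  have sub_swap : ∀ z ∈ offDiagonalStrip T, L (swap z) - L z = κ := fun z hz ↦ by
    have := sub_eq_sub_of_exp_eqOn (convex_offDiagonalStrip T).isPreconnected
      (hL.comp (by fun_prop) swap_mem) (hL.fun_add continuousOn_const) exp_swap hz base_mem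
    simp only [Function.comp_apply] at this
    linear_combination this
  exact ⟨2 * κ, by simpa, fun z hz ↦ by
    linear_combination sub_swap z hz + sub_swap _ (swap_mem hz)⟩

end CrossingIndex

section EmbeddedDisc

open Set Complex Metric Real AffineMap

theorem convex_closedBall_sdiff_singleton {E : Type*} [NormedAddCommGroup E] [NormedSpace ℝ E]
    [StrictConvexSpace ℝ E] {x z : E} {r : ℝ} (hr : r ≠ 0) (hz : z ∈ sphere x r) :
    Convex ℝ (closedBall x r \ {z}) :=
  (((convex_closedBall x r).mem_extremePoints_iff_convex_sdiff).1
    (StrictConvexSpace.sphere_subset_extremePoints_closedBall x hr hz)).2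

theorem circleMap_ne_of_sub_mem_Ioo {c : ℂ} {R x y : ℝ} (hR : R ≠ 0)
    (h : x - y ∈ Ioo 0 (2 * π)) : circleMap c R x ≠ circleMap c R y := fun he ↦
  (sub_pos.1 h.1).ne' <| injOn_circleMap_of_abs_sub_le' hR (by linarith : y + 2 * π - y ≤ 2 * π)
    ⟨by linarith [h.1], by linarith [h.2]⟩ ⟨le_rfl, by linarith [pi_pos]⟩ he

theorem circleMap_mem_punctured_closedBall {x y : ℝ} (h : x - y ∈ Ioo 0 (2 * π)) :
    circleMap 0 1 x ∈ closedBall 0 1 \ {circleMap 0 1 y} ∧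
      circleMap 0 1 y ∈ closedBall 0 1 \ {circleMap 0 1 x} :=
  have hne : circleMap 0 1 x ≠ circleMap 0 1 y := circleMap_ne_of_sub_mem_Ioo one_ne_zero h
  ⟨⟨circleMap_mem_closedBall 0 zero_le_one x, hne⟩,
    circleMap_mem_closedBall 0 zero_le_one y, hne.symm⟩

theorem chord_mem_punctured_closedBall {x y z t : ℝ}
    (hx : circleMap 0 1 x ∈ closedBall 0 1 \ {circleMap 0 1 z})
    (hy : circleMap 0 1 y ∈ closedBall 0 1 \ {circleMap 0 1 z}) (ht : t ∈ Icc 0 1) :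
    lineMap (circleMap 0 1 x) (circleMap 0 1 y) t ∈ closedBall 0 1 \ {circleMap 0 1 z} :=
  (convex_closedBall_sdiff_singleton one_ne_zero
    (circleMap_mem_sphere 0 zero_le_one z)).lineMap_mem hx hy ht

variable {φ : ℂ → ℂ} {L : ℝ × ℝ → ℂ}

theorem logChange_chord_sub (hφ : ContinuousOn φ (closedBall 0 1))
    (hinj : InjOn φ (closedBall 0 1)) (hL : ContinuousOn L (offDiagonalStrip (2 * π)))
    (hLφ : ∀ z ∈ offDiagonalStrip (2 * π),
      exp (L z) = φ (circleMap 0 1 z.1) - φ (circleMap 0 1 z.2))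
    {x x' y : ℝ} (h : x - y ∈ Ioo 0 (2 * π)) (h' : x' - y ∈ Ioo 0 (2 * π)) :
    logChange (fun s ↦ φ (lineMap (circleMap 0 1 x) (circleMap 0 1 x') s) - φ (circleMap 0 1 y)) =
      L (x', y) - L (x, y) := by
  have strip : ∀ u ∈ uIcc x x', u - y ∈ Ioo 0 (2 * π) := fun u hu ↦ by
    rcases mem_uIcc.1 hu with hu | hu <;> exact ⟨by linarith [h.1, h'.1], by linarith [h.2, h'.2]⟩
  exact logChange_comp_lineMap
    (convex_closedBall_sdiff_singleton one_ne_zero (circleMap_mem_sphere 0 zero_le_one y))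
    (f := fun z ↦ φ z - φ (circleMap 0 1 y)) ((hφ.mono sdiff_subset).sub continuousOn_const)
    (fun z hz ↦ sub_ne_zero.2 (hinj.ne hz.1 (circleMap_mem_closedBall 0 zero_le_one y) hz.2))
    (continuous_circleMap 0 1).continuousOn
    (fun u hu ↦ (circleMap_mem_punctured_closedBall (strip u hu)).1)
    (ℓ := fun u ↦ L (u, y)) (hL.comp (by fun_prop) strip) fun u hu ↦ hLφ (u, y) (strip u hu)

theorem logChange_sub_chord (hφ : ContinuousOn φ (closedBall 0 1))
    (hinj : InjOn φ (closedBall 0 1)) (hL : ContinuousOn L (offDiagonalStrip (2 * π)))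
    (hLφ : ∀ z ∈ offDiagonalStrip (2 * π),
      exp (L z) = φ (circleMap 0 1 z.1) - φ (circleMap 0 1 z.2))
    {x y y' : ℝ} (h : x - y ∈ Ioo 0 (2 * π)) (h' : x - y' ∈ Ioo 0 (2 * π)) :
    logChange (fun t ↦ φ (circleMap 0 1 x) - φ (lineMap (circleMap 0 1 y) (circleMap 0 1 y') t)) =
      L (x, y') - L (x, y) := by
  have strip : ∀ u ∈ uIcc y y', x - u ∈ Ioo 0 (2 * π) := fun u hu ↦ by
    rcases mem_uIcc.1 hu with hu | hu <;> exact ⟨by linarith [h.1, h'.1], by linarith [h.2, h'.2]⟩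
  exact logChange_comp_lineMap
    (convex_closedBall_sdiff_singleton one_ne_zero (circleMap_mem_sphere 0 zero_le_one x))
    (f := fun z ↦ φ (circleMap 0 1 x) - φ z) (continuousOn_const.sub (hφ.mono sdiff_subset))
    (fun z hz ↦ sub_ne_zero.2
      (hinj.ne (circleMap_mem_closedBall 0 zero_le_one x) hz.1 (Ne.symm hz.2)))
    (continuous_circleMap 0 1).continuousOn
    (fun u hu ↦ (circleMap_mem_punctured_closedBall (strip u hu)).2)
    (ℓ := fun u ↦ L (x, u)) (hL.comp (by fun_prop) strip) fun u hu ↦ hLφ (x, u) (strip u hu)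

/-- The chords cross once: the four terms telescope to the change of the logarithm of
`φ (exp (i x)) - φ (exp (i y))` under a full turn of both points. -/
theorem crossingIndex_chords_ne_zero (hφ : ContinuousOn φ (closedBall 0 1))
    (hinj : InjOn φ (closedBall 0 1)) {a b c d : ℝ} (hab : a < b) (hbc : b < c) (hcd : c < d)
    (hda : d < a + 2 * π) :
    crossingIndex (fun s ↦ φ (lineMap (circleMap 0 1 a) (circleMap 0 1 c) s))
      (fun t ↦ φ (lineMap (circleMap 0 1 b) (circleMap 0 1 d) t)) ≠ 0 := by
  have hφ_circle : Continuous fun x ↦ φ (circleMap 0 1 x) :=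
    hφ.comp_continuous (continuous_circleMap 0 1) (circleMap_mem_closedBall 0 zero_le_one)
  obtain ⟨L, hL, hLφ⟩ := exists_continuousOn_log_of_convex (convex_offDiagonalStrip (2 * π))
    (f := fun z ↦ φ (circleMap 0 1 z.1) - φ (circleMap 0 1 z.2))
    ((hφ_circle.comp continuous_fst).sub (hφ_circle.comp continuous_snd)).continuousOn
    fun z hz ↦ sub_ne_zero.2 <| hinj.ne (circleMap_mem_closedBall 0 zero_le_one _)
      (circleMap_mem_closedBall 0 zero_le_one _) (circleMap_ne_of_sub_mem_Ioo one_ne_zero hz)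
  obtain ⟨κ, hκ, turn⟩ := exists_log_sub_full_turn_eq two_pi_pos
    ((periodic_circleMap 0 1).comp φ) hL hLφ
  have past_b := logChange_chord_sub hφ hinj hL hLφ (x := a + 2 * π) (x' := c) (y := b)
    ⟨by linarith, by linarith⟩ ⟨by linarith, by linarith⟩
  have past_d := logChange_chord_sub hφ hinj hL hLφ (x := a + 2 * π) (x' := c + 2 * π) (y := d)
    ⟨by linarith, by linarith⟩ ⟨by linarith, by linarith⟩
  have past_c := logChange_sub_chord hφ hinj hL hLφ (x := c) (y := b) (y' := d - 2 * π)
    ⟨by linarith, by linarith⟩ ⟨by linarith, by linarith⟩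
  have past_a := logChange_sub_chord hφ hinj hL hLφ (x := a + 2 * π) (y := b) (y' := d)
    ⟨by linarith, by linarith⟩ ⟨by linarith, by linarith⟩
  have full_turn := turn (c, d - 2 * π) ⟨by simp only; linarith, by simp only; linarith⟩
  simp only [periodic_circleMap 0 1 _, (periodic_circleMap 0 1).sub_eq]
    at past_a past_b past_c past_d
  simp only [sub_add_cancel] at full_turn
  have telescoped : crossingIndex (fun s ↦ φ (lineMap (circleMap 0 1 a) (circleMap 0 1 c) s))
      (fun t ↦ φ (lineMap (circleMap 0 1 b) (circleMap 0 1 d) t)) = -κ := by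
    simp only [crossingIndex, lineMap_apply_zero, lineMap_apply_one, past_a, past_b, past_c, past_d]
    linear_combination -full_turn
  rwa [telescoped, neg_ne_zero]

/-- If `S` and `T` were disjoint, they could be used to close up the two chords of the disc without
creating a crossing, but closed curves in the plane have crossing index `0`. -/
theorem not_disjoint_of_joinedIn_of_crossing (hφ : ContinuousOn φ (closedBall 0 1))
    (hinj : InjOn φ (closedBall 0 1)) {a b c d : ℝ} (hab : a < b) (hbc : b < c) (hcd : c < d)
    (hda : d < a + 2 * π) {S T : Set ℂ}
    (hS : JoinedIn S (φ (circleMap 0 1 a)) (φ (circleMap 0 1 c)))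
    (hT : JoinedIn T (φ (circleMap 0 1 b)) (φ (circleMap 0 1 d)))
    (hSφ : ∀ z ∈ closedBall 0 1, φ z ∈ S → z = circleMap 0 1 a ∨ z = circleMap 0 1 c)
    (hTφ : ∀ z ∈ closedBall 0 1, φ z ∈ T → z = circleMap 0 1 b ∨ z = circleMap 0 1 d) :
    ¬Disjoint S T := by
  intro hST
  obtain ⟨γ, hγ⟩ := hS.symm
  obtain ⟨δ, hδ⟩ := hT.symm
  obtain ⟨ba, ab⟩ := circleMap_mem_punctured_closedBall (x := b) (y := a) ⟨by linarith, by linarith⟩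
  obtain ⟨cb, bc⟩ := circleMap_mem_punctured_closedBall (x := c) (y := b) ⟨by linarith, by linarith⟩
  obtain ⟨dc, cd⟩ := circleMap_mem_punctured_closedBall (x := d) (y := c) ⟨by linarith, by linarith⟩
  obtain ⟨da, ad⟩ := circleMap_mem_punctured_closedBall (x := d) (y := a) ⟨by linarith, by linarith⟩
  refine crossingIndex_chords_ne_zero hφ hinj hab hbc hcd hda <|
    crossingIndex_eq_zero_of_closed (γ := γ.extend) (δ := δ.extend)
      (hφ.comp lineMap_continuous.continuousOn fun s hs ↦
        (chord_mem_punctured_closedBall ab cb hs).1)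
      (hφ.comp lineMap_continuous.continuousOn fun t ht ↦
        (chord_mem_punctured_closedBall ba da ht).1)
      γ.continuous_extend.continuousOn δ.continuous_extend.continuousOn
      (by simp) (by simp) (by simp) (by simp) (fun s _ t ht h ↦ ?_) (fun s hs t _ h ↦ ?_)
      fun s _ t _ ↦ hST.ne_of_mem (hγ _) (hδ _)
  · have avoids_a := chord_mem_punctured_closedBall ba da ht
    have avoids_c := chord_mem_punctured_closedBall bc dc ht
    exact (hSφ _ avoids_a.1 (h ▸ hγ _)).elim avoids_a.2 avoids_c.2
  · have avoids_b := chord_mem_punctured_closedBall ab cb hs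
    have avoids_d := chord_mem_punctured_closedBall ad cd hs
    exact (hTφ _ avoids_b.1 (h ▸ hδ _)).elim avoids_b.2 avoids_d.2

end EmbeddedDisc

section Noncrossing

open Set Metric

/-- No two disjoint paths of `G` join `a` to `c` and `b` to `d`: whenever a subgraph contains both
connections, it connects all four vertices. -/
def IsNoncrossing {V : Type*} (G : SimpleGraph V) (a b c d : V) : Prop :=
  ∀ ⦃K : SimpleGraph V⦄, K ≤ G → K.Reachable a c → K.Reachable b d → K.Reachable a b

theorem exp_mul_I_eq_circleMap (x : ℝ) : Complex.exp (x * Complex.I) = circleMap 0 1 x := by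
  simp [circleMap_zero]

namespace PlaneDrawing

variable {V : Type*} {G : SimpleGraph V} (D : PlaneDrawing G)

/-- The part of the drawing that represents the subgraph of `G` induced by `C`. -/
def carrierOn (C : Set V) : Set ℂ :=
  D.point '' C ∪ {z | ∃ u ∈ C, ∃ v ∈ C, ∃ h : G.Adj u v, z ∈ range (D.arc h)}

theorem carrierOn_subset_carrier (C : Set V) : D.carrierOn C ⊆ D.carrier := by
  rintro z (⟨u, -, rfl⟩ | ⟨u, -, v, -, h, hz⟩)
  · exact Or.inl ⟨u, rfl⟩
  · exact Or.inr ⟨u, v, h, hz⟩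

theorem point_mem_carrierOn {C : Set V} {w : V} : D.point w ∈ D.carrierOn C ↔ w ∈ C := by
  refine ⟨?_, fun hw ↦ Or.inl ⟨w, hw, rfl⟩⟩
  rintro (⟨u, hu, e⟩ | ⟨u, hu, v, hv, h, t, e⟩)
  · rwa [← D.point_injective e]
  · rcases D.eq_or_eq_of_arc_eq_point h t e with hw | hw
    exacts [hw ▸ hu, hw ▸ hv]

theorem disjoint_carrierOn {C C' : Set V} (hCC' : Disjoint C C') :
    Disjoint (D.carrierOn C) (D.carrierOn C') := by
  rw [disjoint_left]
  have no_common_point (w : V) (hw : D.point w ∈ D.carrierOn C) :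
      D.point w ∉ D.carrierOn C' := fun hw' ↦
    disjoint_left.1 hCC' (D.point_mem_carrierOn.1 hw) (D.point_mem_carrierOn.1 hw')
  intro z hz hz'
  obtain ⟨u, -, rfl⟩ | ⟨u, hu, v, -, huv, s, rfl⟩ := id hz
  · exact no_common_point u hz hz'
  obtain ⟨x, -, e⟩ | ⟨x, hx, y, hy, hxy, t, e⟩ := id hz'
  · exact no_common_point x (e ▸ hz) (e ▸ hz')
  have edges_ne : s(u, v) ≠ s(x, y) := fun he ↦ by
    rcases Sym2.eq_iff.1 he with ⟨rfl, -⟩ | ⟨rfl, -⟩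
    · exact disjoint_left.1 hCC' hu hx
    · exact disjoint_left.1 hCC' hu hy
  obtain ⟨w, hw⟩ := D.exists_point_of_arc_eq_arc huv hxy s t edges_ne e.symm
  exact no_common_point w (hw ▸ hz) (hw ▸ hz')

theorem joinedIn_carrierOn_of_reachable {K : SimpleGraph V} (hK : K ≤ G) {u v : V}
    (h : K.Reachable u v) :
    JoinedIn (D.carrierOn {w | K.Reachable u w}) (D.point u) (D.point v) := by
  rw [SimpleGraph.reachable_iff_reflTransGen] at h
  induction h with
  | refl => exact JoinedIn.refl (D.point_mem_carrierOn.2 (.refl u))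
  | @tail v w huv hvw ih =>
    have hv : K.Reachable u v := (SimpleGraph.reachable_iff_reflTransGen u v).2 huv
    exact ih.trans ⟨D.arc (hK hvw), fun t ↦
      Or.inr ⟨v, hv, w, hv.trans hvw.reachable, hK hvw, t, rfl⟩⟩

variable {D} in
theorem IsFace.disjoint_carrier {F : Set ℂ} (hF : D.IsFace F) : Disjoint F D.carrier := by
  obtain ⟨z, -, rfl⟩ := hF
  exact disjoint_left.2 fun _ hz ↦ connectedComponentIn_subset _ _ hz

variable {D} in
theorem InCyclicOrderOn.injective {F : Set ℂ} {n : ℕ} {v : Fin n → V}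
    (hv : D.InCyclicOrderOn F v) : v.Injective := by
  obtain ⟨φ, θ, -, hinj, hmono, hθ, hpoint, -⟩ := hv
  simp only [exp_mul_I_eq_circleMap] at hpoint
  intro i j hij
  have same_point : circleMap 0 1 (θ i) = circleMap 0 1 (θ j) :=
    hinj (circleMap_mem_closedBall 0 zero_le_one _) (circleMap_mem_closedBall 0 zero_le_one _)
      (by rw [hpoint, hpoint, hij])
  exact hmono.injective
    (injOn_circleMap_of_abs_sub_le' one_ne_zero (sub_zero _).le (hθ i) (hθ j) same_point)

theorem isNoncrossing_of_inCyclicOrderOn {F : Set ℂ} (hF : Disjoint F D.carrier) {a b c d : V}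
    (hcyc : D.InCyclicOrderOn F ![a, b, c, d]) : IsNoncrossing G a b c d := by
  obtain ⟨φ, θ, hφ, hinj, hmono, hθ, hpoint, hdisc⟩ := hcyc
  simp only [exp_mul_I_eq_circleMap] at hpoint hdisc
  intro K hK hac hbd
  by_contra hab
  have components_disjoint : Disjoint {w | K.Reachable a w} {w | K.Reachable b w} :=
    disjoint_left.2 fun w haw hbw ↦ hab (SimpleGraph.Reachable.trans haw hbw.symm)
  have meets_disc {C : Set V} {z : ℂ} (hz : z ∈ closedBall 0 1) (hzC : φ z ∈ D.carrierOn C) :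
      ∃ i, z = circleMap 0 1 (θ i) ∧ ![a, b, c, d] i ∈ C := by
    by_contra! hne
    by_cases h : ∃ i, z = circleMap 0 1 (θ i)
    · obtain ⟨i, rfl⟩ := h
      exact hne i rfl (D.point_mem_carrierOn.1 (hpoint i ▸ hzC))
    · exact disjoint_left.1 hF (hdisc z hz (not_exists.1 h)) (D.carrierOn_subset_carrier C hzC)
  have joined_ac := D.joinedIn_carrierOn_of_reachable hK hac
  have joined_bd := D.joinedIn_carrierOn_of_reachable hK hbd
  refine not_disjoint_of_joinedIn_of_crossing hφ hinj (hmono (by decide : (0 : Fin 4) < 1))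
    (hmono (by decide : (1 : Fin 4) < 2)) (hmono (by decide : (2 : Fin 4) < 3))
    (by linarith [(hθ 3).2, (hθ 0).1]) (S := D.carrierOn {w | K.Reachable a w})
    (T := D.carrierOn {w | K.Reachable b w}) (by simpa [hpoint] using joined_ac)
    (by simpa [hpoint] using joined_bd) (fun z hz hzS ↦ ?_) (fun z hz hzT ↦ ?_)
    (D.disjoint_carrierOn components_disjoint)
  · obtain ⟨i, rfl, hi⟩ := meets_disc hz hzS
    fin_cases i
    exacts [Or.inl rfl, absurd hi hab, Or.inr rfl, absurd (hi.trans hbd.symm) hab]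
  · obtain ⟨i, rfl, hi⟩ := meets_disc hz hzT
    fin_cases i
    exacts [absurd hi.symm hab, Or.inl rfl, absurd (hac.trans hi.symm) hab, Or.inr rfl]

end PlaneDrawing

end Noncrossing

section Exchange

open SimpleGraph Set

theorem ncard_le_two_of_connected {W : Type*} [Finite W] {K : SimpleGraph W} (hK : K.Connected)
    (degree_le_two : ∀ v, (K.neighborSet v).ncard ≤ 2) {s : Set W}
    (degree_le_one : ∀ v ∈ s, (K.neighborSet v).ncard ≤ 1) : s.ncard ≤ 2 := by
  classical
  have := Fintype.ofFinite W
  have degree_eq (v : W) : (K.neighborSet v).ncard = K.degree v := by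
    rw [← K.card_neighborFinset_eq_degree v, ← Set.ncard_coe_finset, K.coe_neighborFinset]
  have vertices_le_edges : Fintype.card W ≤ K.edgeFinset.card + 1 := by
    rw [edgeFinset_card, ← Nat.card_eq_fintype_card, ← Nat.card_eq_fintype_card]
    exact hK.card_vert_le_card_edgeSet_add_one
  have degree_add_le : ∑ v, (K.degree v + if v ∈ s then 1 else 0) ≤ ∑ _v : W, 2 :=
    Finset.sum_le_sum fun v _ ↦ by
      have := degree_le_two v
      have := degree_le_one v
      grind
  rw [Finset.sum_add_distrib, K.sum_degrees_eq_twice_card_edges, ← Finset.card_filter,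
    Finset.sum_const, Finset.card_univ, smul_eq_mul] at degree_add_le
  rw [Set.ncard_eq_toFinset_card', ← s.filter_mem_univ_eq_toFinset]
  omega

variable {V : Type*} {G : SimpleGraph V}

/-- No edge of `P` leaves `C`. -/
def IsAdjClosed (P : G.Subgraph) (C : Set V) : Prop :=
  ∀ ⦃u v⦄, P.Adj u v → (u ∈ C ↔ v ∈ C)

/-- The subgraph that agrees with `P` inside `C` and with `Q` outside `C`. -/
def exchange (C : Set V) (P Q : G.Subgraph) : G.Subgraph where
  verts := C.ite P.verts Q.verts
  Adj u v := u ∈ C ∧ v ∈ C ∧ P.Adj u v ∨ u ∉ C ∧ v ∉ C ∧ Q.Adj u v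
  adj_sub := by
    rintro u v (⟨-, -, h⟩ | ⟨-, -, h⟩)
    exacts [h.adj_sub, h.adj_sub]
  edge_vert := by
    rintro u v (⟨hu, -, h⟩ | ⟨hu, -, h⟩)
    exacts [Or.inl ⟨h.fst_mem, hu⟩, Or.inr ⟨h.fst_mem, hu⟩]
  symm := ⟨fun u v h ↦ by simpa only [P.adj_comm u, Q.adj_comm u, and_left_comm] using h⟩

variable {C : Set V} {P Q : G.Subgraph}

theorem exchange_adj {u v : V} : (exchange C P Q).Adj u v ↔
    u ∈ C ∧ v ∈ C ∧ P.Adj u v ∨ u ∉ C ∧ v ∉ C ∧ Q.Adj u v := Iff.rfl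

theorem exchange_adj_of_isAdjClosed (hP : IsAdjClosed P C) (hQ : IsAdjClosed Q C) {u v : V} :
    (exchange C P Q).Adj u v ↔ u ∈ C ∧ P.Adj u v ∨ u ∉ C ∧ Q.Adj u v := by
  have := @hP u v
  have := @hQ u v
  rw [exchange_adj]
  tauto

theorem exchange_exchange (hP : IsAdjClosed P C) :
    exchange C (exchange C P Q) (exchange C Q P) = P := by
  ext u v
  · simp only [exchange, Set.ite, mem_union, mem_inter_iff, mem_sdiff]
    tauto
  · have := @hP u v
    simp only [exchange_adj]
    tauto

theorem exchange_sup_exchange (hP : IsAdjClosed P C) (hQ : IsAdjClosed Q C) :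
    exchange C P Q ⊔ exchange C Q P = P ⊔ Q := by
  ext u v
  · simp only [exchange, Set.ite, Subgraph.verts_sup, mem_union, mem_inter_iff, mem_sdiff]
    tauto
  · simp only [Subgraph.sup_adj, exchange_adj_of_isAdjClosed hP hQ,
      exchange_adj_of_isAdjClosed hQ hP]
    tauto

theorem exchange_le {H : G.Subgraph} (hP : P ≤ H) (hQ : Q ≤ H) : exchange C P Q ≤ H := by
  refine ⟨?_, ?_⟩
  · rintro v (⟨hv, -⟩ | ⟨hv, -⟩)
    exacts [hP.1 hv, hQ.1 hv]
  · rintro u v (⟨-, -, h⟩ | ⟨-, -, h⟩)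
    exacts [hP.2 h, hQ.2 h]

theorem isMatching_exchange (hP : P.IsMatching) (hQ : Q.IsMatching) (hPC : IsAdjClosed P C)
    (hQC : IsAdjClosed Q C) : (exchange C P Q).IsMatching := by
  rintro v (⟨hv, hvC⟩ | ⟨hv, hvC⟩)
  · simpa only [exchange_adj_of_isAdjClosed hPC hQC, hvC, true_and, not_true, false_and, or_false]
      using hP hv
  · simpa only [exchange_adj_of_isAdjClosed hPC hQC, hvC, true_and, not_false_eq_true, false_and,
      false_or] using hQ hv

theorem isPerfectMatchingOf_deleteVerts_iff {H : G.Subgraph} {s : Set V} :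
    IsPerfectMatchingOf (H.deleteVerts s) P ↔ P ≤ H ∧ P.IsMatching ∧ P.verts = H.verts \ s := by
  refine ⟨fun ⟨le, matching, verts⟩ ↦ ⟨le.trans Subgraph.deleteVerts_le, matching, verts⟩,
    fun ⟨le, matching, verts⟩ ↦ ⟨⟨verts.le, fun u v h ↦ ?_⟩, matching, verts⟩⟩
  have hu := verts.le h.fst_mem
  have hv := verts.le h.snd_mem
  exact Subgraph.deleteVerts_adj.2 ⟨hu.1, hu.2, hv.1, hv.2, le.2 h⟩

theorem isPerfectMatchingOf_exchange {H : G.Subgraph} {s t : Set V}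
    (hP : IsPerfectMatchingOf (H.deleteVerts s) P) (hQ : IsPerfectMatchingOf (H.deleteVerts t) Q)
    (hPC : IsAdjClosed P C) (hQC : IsAdjClosed Q C) :
    IsPerfectMatchingOf (H.deleteVerts (C.ite s t)) (exchange C P Q) := by
  rw [isPerfectMatchingOf_deleteVerts_iff] at *
  refine ⟨exchange_le hP.1 hQ.1, isMatching_exchange hP.2.1 hQ.2.1 hPC hQC, ?_⟩
  ext v
  simp only [exchange, Set.ite, hP.2.2, hQ.2.2, mem_union, mem_inter_iff, mem_sdiff]
  tauto

theorem even_ncard_verts_inter [Finite V] (hP : P.IsMatching) (hPC : IsAdjClosed P C) :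
    Even (P.verts ∩ C).ncard := by
  classical
  have := Fintype.ofFinite V
  have restricted : (exchange C P ⊥).IsMatching :=
    isMatching_exchange hP (fun _ hv ↦ hv.elim) hPC fun _ _ h ↦ h.elim
  have := restricted.even_card
  rw [← Set.ncard_eq_toFinset_card'] at this
  simpa [exchange, Set.ite] using this

theorem even_ncard_symmDiff_inter [Finite V] (hP : P.IsMatching) (hQ : Q.IsMatching)
    (hPC : IsAdjClosed P C) (hQC : IsAdjClosed Q C) :
    Even (symmDiff P.verts Q.verts ∩ C).ncard := by
  have even_P := even_ncard_verts_inter hP hPC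
  have even_Q := even_ncard_verts_inter hQ hQC
  have card_sdiff_P := ncard_inter_add_ncard_sdiff_eq_ncard (P.verts ∩ C) (Q.verts ∩ C)
  have card_sdiff_Q := ncard_inter_add_ncard_sdiff_eq_ncard (Q.verts ∩ C) (P.verts ∩ C)
  rw [inter_comm (Q.verts ∩ C)] at card_sdiff_Q
  rw [inter_comm, inter_symmDiff_distrib_left, inter_comm C, inter_comm C, Set.symmDiff_def,
    ncard_union_eq disjoint_sdiff_sdiff]
  grind

theorem ncard_neighborSet_eq_one (hP : P.IsMatching) {v : V} (hv : v ∈ P.verts) :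
    (P.neighborSet v).ncard = 1 := by
  obtain ⟨w, hw, hw_unique⟩ := hP hv
  exact ncard_eq_one.2 ⟨w, eq_singleton_iff_unique_mem.2 ⟨hw, hw_unique⟩⟩

theorem ncard_neighborSet_eq_zero {v : V} (hv : v ∉ P.verts) : (P.neighborSet v).ncard = 0 := by
  have no_neighbor : P.neighborSet v = ∅ :=
    eq_empty_of_forall_notMem fun _ hw ↦ hv (Subgraph.Adj.fst_mem hw)
  rw [no_neighbor, ncard_empty]

/-- The connected component of `a` in the superposition of `P` and `Q`. -/
def superpositionComponent (P Q : G.Subgraph) (a : V) : Set V :=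
  ((P ⊔ Q).spanningCoe.connectedComponentMk a).supp

theorem ncard_symmDiff_inter_superpositionComponent_le_two [Finite V] (hP : P.IsMatching)
    (hQ : Q.IsMatching) (a : V) :
    (symmDiff P.verts Q.verts ∩ superpositionComponent P Q a).ncard ≤ 2 := by
  set c := (P ⊔ Q).spanningCoe.connectedComponentMk a
  have degree_le (v : c) : (c.toSimpleGraph.neighborSet v).ncard ≤
      (P.neighborSet v).ncard + (Q.neighborSet v).ncard := calc
    _ = (Subtype.val '' c.toSimpleGraph.neighborSet v).ncard :=
      (ncard_image_of_injective _ Subtype.val_injective).symm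
    _ ≤ (P.neighborSet v ∪ Q.neighborSet v).ncard :=
      ncard_le_ncard (by rintro _ ⟨w, hw, rfl⟩; exact hw)
    _ ≤ _ := ncard_union_le _ _
  have card_neighbors {M : G.Subgraph} (hM : M.IsMatching) (v : V) :
      v ∈ M.verts ∧ (M.neighborSet v).ncard = 1 ∨ v ∉ M.verts ∧ (M.neighborSet v).ncard = 0 :=
    (em (v ∈ M.verts)).imp (fun hv ↦ ⟨hv, ncard_neighborSet_eq_one hM hv⟩)
      fun hv ↦ ⟨hv, ncard_neighborSet_eq_zero hv⟩
  have unmatched_le_two : (Subtype.val ⁻¹' symmDiff P.verts Q.verts : Set c.supp).ncard ≤ 2 := by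
    refine ncard_le_two_of_connected c.connected_toSimpleGraph (fun v ↦ ?_) fun v hv ↦ ?_
    · have := degree_le v
      grind
    · have := degree_le v
      rw [mem_preimage, mem_symmDiff] at hv
      grind
  rwa [← ncard_image_of_injective _ Subtype.val_injective, Subtype.image_preimage_coe,
    inter_comm] at unmatched_le_two

theorem isAdjClosed_superpositionComponent_left (P Q : G.Subgraph) (a : V) :
    IsAdjClosed P (superpositionComponent P Q a) :=
  fun _ _ h ↦ ConnectedComponent.mem_supp_congr_adj _ (Or.inl h : (P ⊔ Q).Adj _ _)

theorem superpositionComponent_comm (P Q : G.Subgraph) (a : V) :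
    superpositionComponent P Q a = superpositionComponent Q P a := by
  rw [superpositionComponent, superpositionComponent, sup_comm]

theorem isAdjClosed_superpositionComponent_right (P Q : G.Subgraph) (a : V) :
    IsAdjClosed Q (superpositionComponent P Q a) :=
  superpositionComponent_comm P Q a ▸ isAdjClosed_superpositionComponent_left Q P a

theorem mem_superpositionComponent {a v : V} :
    v ∈ superpositionComponent P Q a ↔ (P ⊔ Q).spanningCoe.Reachable v a :=
  ConnectedComponent.eq

theorem mem_superpositionComponent_self (P Q : G.Subgraph) (a : V) :
    a ∈ superpositionComponent P Q a := rfl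

theorem exists_ne_mem_superpositionComponent [Finite V] (hP : P.IsMatching)
    (hQ : Q.IsMatching) {a : V} (ha : a ∈ symmDiff P.verts Q.verts) :
    ∃ v ∈ symmDiff P.verts Q.verts, v ≠ a ∧ v ∈ superpositionComponent P Q a := by
  have even_unmatched := even_ncard_symmDiff_inter hP hQ
    (isAdjClosed_superpositionComponent_left P Q a)
    (isAdjClosed_superpositionComponent_right P Q a)
  by_contra! h
  have only_a : symmDiff P.verts Q.verts ∩ superpositionComponent P Q a = {a} :=
    eq_singleton_iff_unique_mem.2 ⟨⟨ha, mem_superpositionComponent_self P Q a⟩,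
      fun v hv ↦ by_contra fun hne ↦ h v hv.1 hne hv.2⟩
  simp [only_a] at even_unmatched

theorem superpositionComponent_separates [Finite V] {a b c d : V} (distinct : [a, b, c, d].Nodup)
    (hG : IsNoncrossing G a b c d) (hP : P.IsMatching) (hQ : Q.IsMatching)
    (hPQ : symmDiff P.verts Q.verts = {a, b, c, d}) :
    c ∉ superpositionComponent P Q a ∧
      (b ∈ superpositionComponent P Q a ↔ d ∉ superpositionComponent P Q a) := by
  have at_most_two : ¬ ∃ x y z, x ∈ _ ∧ y ∈ _ ∧ z ∈ _ ∧ x ≠ y ∧ x ≠ z ∧ y ≠ z :=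
    (two_lt_ncard_iff (toFinite _)).not.1
      (ncard_symmDiff_inter_superpositionComponent_le_two hP hQ a).not_gt
  obtain ⟨a', ha, ha_ne, ha_mem⟩ :=
    exists_ne_mem_superpositionComponent hP hQ (a := a) (by simp [hPQ])
  obtain ⟨b', hb, hb_ne, hb_mem⟩ :=
    exists_ne_mem_superpositionComponent hP hQ (a := b) (by simp [hPQ])
  simp only [hPQ, mem_inter_iff, mem_insert_iff, mem_singleton_iff, List.nodup_cons,
    mem_superpositionComponent] at *
  have c_notMem : ¬ (P ⊔ Q).spanningCoe.Reachable c a := fun hca ↦ by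
    have hba : ¬ (P ⊔ Q).spanningCoe.Reachable b a := fun hba ↦
      at_most_two ⟨a, b, c, by grind [Reachable.refl]⟩
    have hbd : (P ⊔ Q).spanningCoe.Reachable b d := by
      grind [Reachable.symm, Reachable.trans]
    exact hba (hG (Subgraph.spanningCoe_le _) hca.symm hbd).symm
  have not_both : ¬ ((P ⊔ Q).spanningCoe.Reachable b a ∧ (P ⊔ Q).spanningCoe.Reachable d a) :=
    fun h ↦ at_most_two ⟨a, b, d, by grind [Reachable.refl]⟩
  grind

/-- Exchanges the two entries of a pair outside the component of `a` in their superposition. -/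
def switch (a : V) (p : G.Subgraph × G.Subgraph) : G.Subgraph × G.Subgraph :=
  (exchange (superpositionComponent p.1 p.2 a) p.1 p.2,
    exchange (superpositionComponent p.1 p.2 a) p.2 p.1)

theorem switch_switch (a : V) (p : G.Subgraph × G.Subgraph) : switch a (switch a p) = p := by
  have hP := isAdjClosed_superpositionComponent_left p.1 p.2 a
  have hQ := isAdjClosed_superpositionComponent_right p.1 p.2 a
  have same_component : superpositionComponent (switch a p).1 (switch a p).2 a =
      superpositionComponent p.1 p.2 a :=
    congrArg (fun M : G.Subgraph ↦ (M.spanningCoe.connectedComponentMk a).supp)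
      (exchange_sup_exchange hP hQ)
  rw [switch, same_component]
  exact Prod.ext (exchange_exchange hP) (exchange_exchange hQ)

end Exchange

section Condensation

open SimpleGraph Set

variable {V R : Type*} [Fintype V] [CommRing R] {G : SimpleGraph V} {a b c d : V}

open Classical in
/-- The product of the weights of the edges of `P`. -/
noncomputable def matchingWeight (ω : Sym2 V → R) (P : G.Subgraph) : R :=
  ∏ e ∈ P.edgeSet.toFinset, ω e

open Classical in
theorem matchingSum_eq_sum_matchingWeight (ω : Sym2 V → R) (H : G.Subgraph) :
    matchingSum ω H = ∑ P : G.Subgraph with IsPerfectMatchingOf H P, matchingWeight ω P := rfl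

theorem matchingWeight_exchange_mul (ω : Sym2 V → R) {C : Set V} {P Q : G.Subgraph}
    (hP : IsAdjClosed P C) (hQ : IsAdjClosed Q C) :
    matchingWeight ω (exchange C P Q) * matchingWeight ω (exchange C Q P) =
      matchingWeight ω P * matchingWeight ω Q := by
  classical
  have weight_eq (M : G.Subgraph) :
      matchingWeight ω M = ∏ e, if e ∈ M.edgeSet then ω e else 1 := by
    rw [matchingWeight, ← Finset.prod_filter, Set.filter_mem_univ_eq_toFinset]
  simp only [weight_eq, ← Finset.prod_mul_distrib]
  refine Finset.prod_congr rfl fun e _ ↦ ?_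
  induction e with | h u v
  by_cases hu : u ∈ C <;>
    simp [exchange_adj_of_isAdjClosed, hP, hQ, hu, mul_comm]

open Classical in
/-- The pairs consisting of a perfect matching of `H - s` and a perfect matching of `H - t`. -/
noncomputable def matchingPairs (H : G.Subgraph) (s t : Set V) :
    Finset (G.Subgraph × G.Subgraph) :=
  {p | IsPerfectMatchingOf (H.deleteVerts s) p.1 ∧ IsPerfectMatchingOf (H.deleteVerts t) p.2}

theorem mem_matchingPairs {H : G.Subgraph} {s t : Set V} {p : G.Subgraph × G.Subgraph} :
    p ∈ matchingPairs H s t ↔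
      IsPerfectMatchingOf (H.deleteVerts s) p.1 ∧ IsPerfectMatchingOf (H.deleteVerts t) p.2 := by
  simp [matchingPairs]

theorem sum_matchingPairs (ω : Sym2 V → R) (H : G.Subgraph) (s t : Set V) :
    ∑ p ∈ matchingPairs H s t, matchingWeight ω p.1 * matchingWeight ω p.2 =
      matchingSum ω (H.deleteVerts s) * matchingSum ω (H.deleteVerts t) := by
  simp only [matchingSum_eq_sum_matchingWeight, Finset.sum_mul_sum, ← Finset.sum_product',
    ← Finset.filter_product, Finset.univ_product_univ, matchingPairs]

theorem disjoint_matchingPairs {H : G.Subgraph} {s t s' t' : Set V} {v : V} (hv : v ∈ H.verts)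
    (hs : v ∈ s) (hs' : v ∉ s') : Disjoint (matchingPairs H s t) (matchingPairs H s' t') := by
  refine Finset.disjoint_left.2 fun p hp hp' ↦ ?_
  have covered : v ∈ p.1.verts := (mem_matchingPairs.1 hp').1.2.2.ge ⟨hv, hs'⟩
  exact ((mem_matchingPairs.1 hp).1.2.2.le covered).2 hs

theorem matchingWeight_switch (ω : Sym2 V → R) (a : V) (p : G.Subgraph × G.Subgraph) :
    matchingWeight ω (switch a p).1 * matchingWeight ω (switch a p).2 =
      matchingWeight ω p.1 * matchingWeight ω p.2 :=
  matchingWeight_exchange_mul ω (isAdjClosed_superpositionComponent_left p.1 p.2 a)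
    (isAdjClosed_superpositionComponent_right p.1 p.2 a)

theorem switch_mem_matchingPairs {H : G.Subgraph} {s t : Set V} {p : G.Subgraph × G.Subgraph}
    (hp : p ∈ matchingPairs H s t) (a : V) :
    let C := superpositionComponent p.1 p.2 a
    switch a p ∈ matchingPairs H (C.ite s t) (C.ite t s) := by
  have hP := isAdjClosed_superpositionComponent_left p.1 p.2 a
  have hQ := isAdjClosed_superpositionComponent_right p.1 p.2 a
  obtain ⟨h₁, h₂⟩ := mem_matchingPairs.1 hp
  exact mem_matchingPairs.2
    ⟨isPerfectMatchingOf_exchange h₁ h₂ hP hQ, isPerfectMatchingOf_exchange h₂ h₁ hQ hP⟩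

theorem symmDiff_verts_of_mem_matchingPairs {H : G.Subgraph} {s t : Set V}
    {p : G.Subgraph × G.Subgraph} (hp : p ∈ matchingPairs H s t) :
    symmDiff p.1.verts p.2.verts = H.verts ∩ symmDiff s t := by
  obtain ⟨⟨-, -, h₁⟩, -, -, h₂⟩ := mem_matchingPairs.1 hp
  ext v
  simp only [h₁, h₂, Subgraph.deleteVerts_verts, mem_symmDiff, mem_sdiff, mem_inter_iff]
  tauto

theorem sum_matchingPairs_switch (ω : Sym2 V → R) (a : V) {S T : Finset (G.Subgraph × G.Subgraph)}
    (hST : ∀ p ∈ S, switch a p ∈ T) (hTS : ∀ p ∈ T, switch a p ∈ S) :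
    ∑ p ∈ S, matchingWeight ω p.1 * matchingWeight ω p.2 =
      ∑ p ∈ T, matchingWeight ω p.1 * matchingWeight ω p.2 :=
  Finset.sum_nbij' (switch a) (switch a) hST hTS (fun p _ ↦ switch_switch a p)
    (fun p _ ↦ switch_switch a p) fun p _ ↦ (matchingWeight_switch ω a p).symm

open Classical in
theorem switch_mem_union (distinct : [a, b, c, d].Nodup) (hG : IsNoncrossing G a b c d)
    {H : G.Subgraph} (hH : {a, b, c, d} ⊆ H.verts) {s t s₁ t₁ s₂ t₂ : Set V}
    (hst : symmDiff s t = {a, b, c, d})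
    (hab : ∀ C : Set V, a ∈ C → b ∈ C → c ∉ C → d ∉ C → C.ite s t = s₁ ∧ C.ite t s = t₁)
    (had : ∀ C : Set V, a ∈ C → b ∉ C → c ∉ C → d ∈ C → C.ite s t = s₂ ∧ C.ite t s = t₂)
    {p : G.Subgraph × G.Subgraph} (hp : p ∈ matchingPairs H s t) :
    switch a p ∈ matchingPairs H s₁ t₁ ∪ matchingPairs H s₂ t₂ := by
  have switched := switch_mem_matchingPairs hp a
  obtain ⟨⟨-, hP, -⟩, -, hQ, -⟩ := mem_matchingPairs.1 hp
  have unmatched := symmDiff_verts_of_mem_matchingPairs hp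
  rw [hst, inter_eq_right.2 hH] at unmatched
  obtain ⟨hc, hbd⟩ := superpositionComponent_separates distinct hG hP hQ unmatched
  have ha := mem_superpositionComponent_self p.1 p.2 a
  by_cases hb : b ∈ superpositionComponent p.1 p.2 a
  · obtain ⟨hs, ht⟩ := hab _ ha hb hc (hbd.1 hb)
    exact Finset.mem_union_left _ (hs ▸ ht ▸ switched)
  · obtain ⟨hs, ht⟩ := had _ ha hb hc (not_not.1 (hbd.not.1 hb))
    exact Finset.mem_union_right _ (hs ▸ ht ▸ switched)

theorem kuo_condensation (distinct : [a, b, c, d].Nodup) (hG : IsNoncrossing G a b c d)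
    {H : G.Subgraph} (hH : {a, b, c, d} ⊆ H.verts) (ω : Sym2 V → R) :
    matchingSum ω H * matchingSum ω (H.deleteVerts {a, b, c, d}) +
        matchingSum ω (H.deleteVerts {b, d}) * matchingSum ω (H.deleteVerts {a, c}) =
      matchingSum ω (H.deleteVerts {c, d}) * matchingSum ω (H.deleteVerts {a, b}) +
        matchingSum ω (H.deleteVerts {b, c}) * matchingSum ω (H.deleteVerts {a, d}) := by
  classical
  rw [← H.deleteVerts_empty]
  simp only [Subgraph.deleteVerts_deleteVerts, empty_union, ← sum_matchingPairs]
  rw [← Finset.sum_union, ← Finset.sum_union]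
  · refine sum_matchingPairs_switch ω a (fun p hp ↦ ?_) fun p hp ↦ ?_
    · rcases Finset.mem_union.1 hp with hp | hp
      · refine switch_mem_union distinct hG hH ?_ ?_ ?_ hp <;> grind [Set.ite, Set.symmDiff_def]
      · rw [Finset.union_comm]
        refine switch_mem_union distinct hG hH ?_ ?_ ?_ hp <;> grind [Set.ite, Set.symmDiff_def]
    · rcases Finset.mem_union.1 hp with hp | hp
      · refine switch_mem_union distinct hG hH ?_ ?_ ?_ hp <;> grind [Set.ite, Set.symmDiff_def]
      · rw [Finset.union_comm]
        refine switch_mem_union distinct hG hH ?_ ?_ ?_ hp <;> grind [Set.ite, Set.symmDiff_def]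
  · exact disjoint_matchingPairs (v := d) (hH (by simp)) (by simp) (by grind)
  · exact (disjoint_matchingPairs (v := b) (hH (by simp)) (by simp) (by simp)).symm

end Condensation

section EdgeExpansion

open SimpleGraph Set

variable {V : Type*} {G : SimpleGraph V} {C : Set V} {P Q : G.Subgraph} {a b : V}

theorem isAdjClosed_of_verts_subset (h : P.verts ⊆ C) :
    IsAdjClosed P C :=
  fun _ _ huv ↦ iff_of_true (h huv.fst_mem) (h huv.snd_mem)

theorem isAdjClosed_of_disjoint_verts (h : Disjoint P.verts C) :
    IsAdjClosed P C :=
  fun _ _ huv ↦ iff_of_false (Set.disjoint_left.1 h huv.fst_mem)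
    (Set.disjoint_left.1 h huv.snd_mem)

theorem isAdjClosed_pair (hP : P.IsMatching) (hab : P.Adj a b) :
    IsAdjClosed P {a, b} := by
  intro u v huv
  simp only [mem_insert_iff, mem_singleton_iff]
  grind [hP.eq_of_adj_left, hP.eq_of_adj_right, Subgraph.adj_comm]

theorem exchange_bot_of_disjoint_verts (h : Disjoint P.verts C) :
    exchange C ⊥ P = P := by
  rw [Set.disjoint_left] at h
  ext u v
  · simp only [exchange, Set.ite, mem_union, mem_inter_iff, mem_sdiff, Subgraph.verts_bot]
    grind
  · have := @h u
    have := @h v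
    simp only [exchange_adj, Subgraph.not_bot_adj]
    grind [Subgraph.Adj.fst_mem, Subgraph.Adj.snd_mem]

theorem exchange_exchange_right {S : G.Subgraph} :
    exchange C P (exchange C S Q) = exchange C P Q := by
  ext u v
  · simp only [exchange, Set.ite, mem_union, mem_inter_iff, mem_sdiff]
    tauto
  · simp only [exchange_adj]
    tauto

theorem exchange_subgraphOfAdj_eq_self (hP : P.IsMatching) (hab : P.Adj a b) :
    exchange {a, b} (G.subgraphOfAdj hab.adj_sub) P = P := by
  ext u v
  · have := hab.fst_mem
    have := hab.snd_mem
    simp only [exchange, Set.ite, subgraphOfAdj_verts]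
    grind
  · have := @isAdjClosed_pair _ _ _ _ _ hP hab u v
    simp only [exchange_adj, subgraphOfAdj_adj, Sym2.eq_iff, mem_insert_iff, mem_singleton_iff]
    grind [Subgraph.Adj.ne, Subgraph.adj_comm]

theorem exchange_eq_bot (hP : Disjoint P.verts C) (hQ : Q.verts ⊆ C) : exchange C P Q = ⊥ := by
  rw [Set.disjoint_left] at hP
  ext u v
  · simp only [exchange, Set.ite, mem_union, mem_inter_iff, mem_sdiff, Subgraph.verts_bot]
    grind
  · simp only [exchange_adj, Subgraph.not_bot_adj]
    grind [Subgraph.Adj.fst_mem]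

theorem isPerfectMatchingOf_subgraphOfAdj {H : G.Subgraph} (hab : H.Adj a b) :
    IsPerfectMatchingOf (H.deleteVerts {a, b}ᶜ) (G.subgraphOfAdj hab.adj_sub) := by
  refine isPerfectMatchingOf_deleteVerts_iff.2
    ⟨subgraphOfAdj_le_of_adj H hab, Subgraph.IsMatching.subgraphOfAdj _, ?_⟩
  rw [subgraphOfAdj_verts, sdiff_compl, eq_comm]
  exact inter_eq_right.2 (pair_subset hab.fst_mem hab.snd_mem)

theorem isPerfectMatchingOf_bot (H : G.Subgraph) :
    IsPerfectMatchingOf (H.deleteVerts univ) ⊥ :=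
  isPerfectMatchingOf_deleteVerts_iff.2 ⟨bot_le, fun _ hv ↦ hv.elim, by simp⟩

theorem disjoint_verts_of_isPerfectMatchingOf_deleteVerts {H : G.Subgraph}
    (hP : IsPerfectMatchingOf (H.deleteVerts C) P) : Disjoint P.verts C := by
  rw [hP.2.2, Subgraph.deleteVerts_verts]
  exact disjoint_sdiff_left

theorem isPerfectMatchingOf_exchange_subgraphOfAdj {H : G.Subgraph} (hab : H.Adj a b)
    (hP : IsPerfectMatchingOf (H.deleteVerts {a, b}) P) :
    IsPerfectMatchingOf H (exchange {a, b} (G.subgraphOfAdj hab.adj_sub) P) := by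
  have := isPerfectMatchingOf_exchange (isPerfectMatchingOf_subgraphOfAdj hab) hP
    (isAdjClosed_of_verts_subset Subset.rfl)
    (isAdjClosed_of_disjoint_verts (disjoint_verts_of_isPerfectMatchingOf_deleteVerts hP))
  simpa [Set.ite] using this

theorem isPerfectMatchingOf_exchange_bot {H : G.Subgraph}
    (hP : IsPerfectMatchingOf H P) (hab : P.Adj a b) :
    IsPerfectMatchingOf (H.deleteVerts {a, b}) (exchange {a, b} ⊥ P) := by
  rw [← H.deleteVerts_empty] at hP
  have := isPerfectMatchingOf_exchange (isPerfectMatchingOf_bot H) hP (fun _ _ h ↦ h.elim)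
    (isAdjClosed_pair hP.2.1 hab)
  simpa [Set.ite] using this

theorem isPerfectMatchingOf_deleteEdges_iff {H : G.Subgraph} :
    IsPerfectMatchingOf (H.deleteEdges {s(a, b)}) P ↔ IsPerfectMatchingOf H P ∧ ¬ P.Adj a b := by
  refine ⟨fun ⟨le, matching, verts⟩ ↦
    ⟨⟨le.trans (H.deleteEdges_le _), matching, verts⟩, fun hab ↦ ?_⟩,
    fun ⟨⟨le, matching, verts⟩, hab⟩ ↦ ⟨⟨le.1, fun u v huv ↦ ?_⟩, matching, verts⟩⟩
  · exact ((Subgraph.deleteEdges_adj _ _ _).1 (le.2 hab)).2 rfl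
  · refine (Subgraph.deleteEdges_adj _ _ _).2 ⟨le.2 huv, fun h ↦ hab ?_⟩
    rwa [← Subgraph.mem_edgeSet, ← mem_singleton_iff.1 h]

theorem deleteVerts_deleteEdges_congr {H : G.Subgraph} {C : Set V} {S T : Set (Sym2 V)}
    (h : ∀ e, (∀ v ∈ e, v ∉ C) → (e ∈ S ↔ e ∈ T)) :
    (H.deleteEdges S).deleteVerts C = (H.deleteEdges T).deleteVerts C := by
  ext u v
  · rfl
  · have := h s(u, v)
    simp only [Sym2.mem_iff] at this
    simp only [Subgraph.deleteVerts_adj, Subgraph.deleteEdges_adj, Subgraph.deleteEdges_verts]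
    grind

theorem deleteVerts_deleteEdges_eq_self {H : G.Subgraph} {C : Set V} {S : Set (Sym2 V)}
    (h : ∀ e ∈ S, ∃ v ∈ e, v ∈ C) : (H.deleteEdges S).deleteVerts C = H.deleteVerts C := by
  rw [← congrArg (Subgraph.deleteVerts · C) H.deleteEdges_empty_eq]
  exact deleteVerts_deleteEdges_congr fun e _ ↦ by grind

theorem deleteVerts_deleteEdges_comm {H : G.Subgraph} {C : Set V} {S : Set (Sym2 V)} :
    (H.deleteVerts C).deleteEdges S = (H.deleteEdges S).deleteVerts C := by
  ext u v
  · rfl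
  · simp only [Subgraph.deleteVerts_adj, Subgraph.deleteEdges_adj, Subgraph.deleteEdges_verts]
    tauto

variable {R : Type*} [Fintype V] [CommRing R]

theorem matchingWeight_exchange_subgraphOfAdj (ω : Sym2 V → R) (hab : G.Adj a b)
    (hP : Disjoint P.verts {a, b}) :
    matchingWeight ω (exchange {a, b} (G.subgraphOfAdj hab) P) =
      ω s(a, b) * matchingWeight ω P := by
  have hab_verts : (G.subgraphOfAdj hab).verts ⊆ {a, b} := Subset.rfl
  have := matchingWeight_exchange_mul ω (isAdjClosed_of_verts_subset hab_verts)
    (isAdjClosed_of_disjoint_verts hP)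
  simpa [exchange_eq_bot hP hab_verts, matchingWeight] using this

open Classical in
theorem sum_filter_adj_matchingWeight (ω : Sym2 V → R) {H : G.Subgraph} (hab : H.Adj a b) :
    ∑ P : G.Subgraph with IsPerfectMatchingOf H P ∧ P.Adj a b, matchingWeight ω P =
      ω s(a, b) * matchingSum ω (H.deleteVerts {a, b}) := by
  rw [matchingSum_eq_sum_matchingWeight, Finset.mul_sum]
  symm
  refine Finset.sum_nbij' (exchange {a, b} (G.subgraphOfAdj hab.adj_sub)) (exchange {a, b} ⊥)
    ?_ ?_ ?_ ?_ ?_ <;> simp only [Finset.mem_filter_univ]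
  · exact fun P hP ↦ ⟨isPerfectMatchingOf_exchange_subgraphOfAdj hab hP, by simp [exchange_adj]⟩
  · exact fun P hP ↦ isPerfectMatchingOf_exchange_bot hP.1 hP.2
  · intro P hP
    rw [exchange_exchange_right, exchange_bot_of_disjoint_verts
      (disjoint_verts_of_isPerfectMatchingOf_deleteVerts hP)]
  · intro P hP
    rw [exchange_exchange_right, exchange_subgraphOfAdj_eq_self hP.1.2.1 hP.2]
  · exact fun P hP ↦ (matchingWeight_exchange_subgraphOfAdj ω hab.adj_sub
      (disjoint_verts_of_isPerfectMatchingOf_deleteVerts hP)).symm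

theorem matchingSum_eq_add (ω : Sym2 V → R) {H : G.Subgraph} (hab : H.Adj a b) :
    matchingSum ω H = matchingSum ω (H.deleteEdges {s(a, b)}) +
      ω s(a, b) * matchingSum ω (H.deleteVerts {a, b}) := by
  classical
  rw [← sum_filter_adj_matchingWeight ω hab]
  simp only [matchingSum_eq_sum_matchingWeight, isPerfectMatchingOf_deleteEdges_iff,
    ← Finset.filter_filter]
  exact (Finset.sum_filter_not_add_sum_filter _ (fun P : G.Subgraph ↦ P.Adj a b) _).symm

theorem matchingSum_deleteEdges_eq_add (ω : Sym2 V → R) {H : G.Subgraph} (hab : H.Adj a b)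
    {S : Set (Sym2 V)} (hS : s(a, b) ∉ S) :
    matchingSum ω (H.deleteEdges S) = matchingSum ω (H.deleteEdges (insert s(a, b) S)) +
      ω s(a, b) * matchingSum ω ((H.deleteEdges (insert s(a, b) S)).deleteVerts {a, b}) := by
  have same_deleteVerts : (H.deleteEdges (insert s(a, b) S)).deleteVerts {a, b} =
      (H.deleteEdges S).deleteVerts {a, b} :=
    deleteVerts_deleteEdges_congr fun e he ↦ by grind [Sym2.mem_mk_left a b]
  rw [same_deleteVerts, matchingSum_eq_add ω ((Subgraph.deleteEdges_adj _ _ _).2 ⟨hab, hS⟩),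
    Subgraph.deleteEdges_deleteEdges, union_singleton]

theorem matchingSum_eq_add_of_two_edges (ω : Sym2 V → R) {H : G.Subgraph} {c d : V}
    (distinct : [a, b, c, d].Nodup) (hab : H.Adj a b) (hcd : H.Adj c d) :
    letI N := H.deleteEdges {s(a, b), s(c, d)}
    matchingSum ω H = matchingSum ω (H.deleteEdges {s(a, b)}) +
      ω s(a, b) * (matchingSum ω (N.deleteVerts {a, b}) +
        ω s(c, d) * matchingSum ω (N.deleteVerts {a, b, c, d})) := by
  have hcd' : (H.deleteVerts {a, b}).Adj c d := by
    rw [Subgraph.deleteVerts_adj]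
    grind [hcd.fst_mem, hcd.snd_mem]
  have delete_ab : (H.deleteEdges {s(a, b), s(c, d)}).deleteVerts {a, b} =
      (H.deleteVerts {a, b}).deleteEdges {s(c, d)} := by
    rw [deleteVerts_deleteEdges_comm]
    exact deleteVerts_deleteEdges_congr fun e he ↦ by grind [Sym2.mem_mk_left a b]
  have delete_abcd : (H.deleteEdges {s(a, b), s(c, d)}).deleteVerts {a, b, c, d} =
      (H.deleteVerts {a, b}).deleteVerts {c, d} := by
    rw [Subgraph.deleteVerts_deleteVerts, insert_union, singleton_union]
    exact deleteVerts_deleteEdges_eq_self fun e he ↦ by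
      grind [Sym2.mem_mk_left a b, Sym2.mem_mk_left c d]
  rw [delete_ab, delete_abcd, ← matchingSum_eq_add ω hcd', ← matchingSum_eq_add ω hab]

end EdgeExpansion

theorem two_edge_condensation {V R : Type*} [Fintype V] [CommRing R] {G : SimpleGraph V}
    {a₁ b₁ a₂ b₂ : V} (distinct : [a₁, b₁, a₂, b₂].Nodup) (hG : IsNoncrossing G a₁ b₁ a₂ b₂)
    {H : G.Subgraph} (h₁ : H.Adj a₁ b₁) (h₂ : H.Adj a₂ b₂) (ω : Sym2 V → R) :
    matchingSum ω H * matchingSum ω (H.deleteEdges {s(a₁, b₁), s(a₂, b₂)}) +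
        ω s(a₁, b₁) * ω s(a₂, b₂) *
          (matchingSum ω (H.deleteVerts {a₁, a₂}) * matchingSum ω (H.deleteVerts {b₁, b₂})) =
      matchingSum ω (H.deleteEdges {s(a₁, b₁)}) * matchingSum ω (H.deleteEdges {s(a₂, b₂)}) +
        ω s(a₁, b₁) * ω s(a₂, b₂) *
          (matchingSum ω (H.deleteVerts {a₁, b₂}) * matchingSum ω (H.deleteVerts {a₂, b₁})) := by
  set N := H.deleteEdges {s(a₁, b₁), s(a₂, b₂)} with hN
  have edges_ne : s(a₁, b₁) ≠ s(a₂, b₂) := by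
    rw [ne_eq, Sym2.eq_iff]
    grind
  have expand_e₁ : matchingSum ω (H.deleteEdges {s(a₂, b₂)}) =
      matchingSum ω N + ω s(a₁, b₁) * matchingSum ω (N.deleteVerts {a₁, b₁}) :=
    matchingSum_deleteEdges_eq_add ω h₁ edges_ne
  have expand_e₂ : matchingSum ω (H.deleteEdges {s(a₁, b₁)}) =
      matchingSum ω N + ω s(a₂, b₂) * matchingSum ω (N.deleteVerts {a₂, b₂}) := by
    rw [hN, Set.pair_comm]
    exact matchingSum_deleteEdges_eq_add ω h₂ edges_ne.symm
  have same_deleteVerts {u v : V} (hu : u = a₁ ∨ u = b₁) (hv : v = a₂ ∨ v = b₂) :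
      H.deleteVerts {u, v} = N.deleteVerts {u, v} :=
    (deleteVerts_deleteEdges_eq_self (by aesop)).symm
  have condensation := kuo_condensation distinct hG (H := N)
    (by simp [N, Set.insert_subset_iff, h₁.fst_mem, h₁.snd_mem, h₂.fst_mem, h₂.snd_mem]) ω
  rw [Set.pair_comm a₂ b₁, same_deleteVerts (.inl rfl) (.inl rfl),
    same_deleteVerts (.inr rfl) (.inr rfl), same_deleteVerts (.inl rfl) (.inr rfl),
    same_deleteVerts (.inr rfl) (.inl rfl), matchingSum_eq_add_of_two_edges ω distinct h₁ h₂,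
    ← hN, expand_e₁, expand_e₂]
  linear_combination ω s(a₁, b₁) * ω s(a₂, b₂) * condensation

theorem corollary3p3_general {V R : Type*} [Fintype V] [CommRing R]
    (G : SimpleGraph V) (D : PlaneDrawing G) (ω : Sym2 V → R)
    (a₁ b₁ a₂ b₂ : V) (h₁ : G.Adj a₁ b₁) (h₂ : G.Adj a₂ b₂)
    (g : Set ℂ) (hg : D.IsFace g) (hcyc : D.InCyclicOrderOn g ![a₁, b₁, a₂, b₂]) :
    matchingSum ω (⊤ : G.Subgraph) *
          matchingSum ω ((⊤ : G.Subgraph).deleteEdges {s(a₁, b₁), s(a₂, b₂)}) +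
        ω s(a₁, b₁) * ω s(a₂, b₂) *
          (matchingSum ω ((⊤ : G.Subgraph).deleteVerts {a₁, a₂}) *
            matchingSum ω ((⊤ : G.Subgraph).deleteVerts {b₁, b₂})) =
      matchingSum ω ((⊤ : G.Subgraph).deleteEdges {s(a₁, b₁)}) *
          matchingSum ω ((⊤ : G.Subgraph).deleteEdges {s(a₂, b₂)}) +
        ω s(a₁, b₁) * ω s(a₂, b₂) *
          (matchingSum ω ((⊤ : G.Subgraph).deleteVerts {a₁, b₂}) *
            matchingSum ω ((⊤ : G.Subgraph).deleteVerts {a₂, b₁})) := by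
  have distinct : [a₁, b₁, a₂, b₂].Nodup := by
    simpa using List.nodup_ofFn.2 hcyc.injective
  have noncrossing : IsNoncrossing G a₁ b₁ a₂ b₂ :=
    D.isNoncrossing_of_inCyclicOrderOn hg.disjoint_carrier hcyc
  exact two_edge_condensation distinct noncrossing
    (SimpleGraph.Subgraph.top_adj.2 h₁) (SimpleGraph.Subgraph.top_adj.2 h₂) ω

theorem corollary3p3 {V R : Type*} [Fintype V] [CommRing R]
    (G : SimpleGraph V) (D : PlaneDrawing G) (ω : Sym2 V → R)
    (hV : Even (Fintype.card V))
    (a₁ b₁ a₂ b₂ : V) (h₁ : G.Adj a₁ b₁) (h₂ : G.Adj a₂ b₂)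
    (hind : Disjoint ({a₁, b₁} : Set V) {a₂, b₂})
    (f : Set ℂ) (hf : D.IsFace f)
    (hf₁ : D.EdgeOnBoundary f h₁) (hf₂ : D.EdgeOnBoundary f h₂)
    (g : Set ℂ) (hg : D.IsFace g) (hcyc : D.InCyclicOrderOn g ![a₁, b₁, a₂, b₂]) :
    matchingSum ω (⊤ : G.Subgraph) *
          matchingSum ω ((⊤ : G.Subgraph).deleteEdges {s(a₁, b₁), s(a₂, b₂)}) +
        ω s(a₁, b₁) * ω s(a₂, b₂) *
          (matchingSum ω ((⊤ : G.Subgraph).deleteVerts {a₁, a₂}) *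
            matchingSum ω ((⊤ : G.Subgraph).deleteVerts {b₁, b₂})) =
      matchingSum ω ((⊤ : G.Subgraph).deleteEdges {s(a₁, b₁)}) *
          matchingSum ω ((⊤ : G.Subgraph).deleteEdges {s(a₂, b₂)}) +
        ω s(a₁, b₁) * ω s(a₂, b₂) *
          (matchingSum ω ((⊤ : G.Subgraph).deleteVerts {a₁, b₂}) *
            matchingSum ω ((⊤ : G.Subgraph).deleteVerts {a₂, b₁})) :=
  corollary3p3_general G D ω a₁ b₁ a₂ b₂ h₁ h₂ g hg hcyc
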